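/- An \emph{infinite rewiring map} is a symmetric array $W=(W_{ij})_{i,j\in\mathbb{N}}$ with entries in $\{0,1\}\times\{0,1\}$ and all diagonal entries equal to $(0,0)$; for $n\ge 1$, a rewiring map on $[n]=\{1,\dots,n\}$ is an $n\times n$ array with the same properties, and $\mathcal{W}_n$ denotes the finite set of these. The restriction of $W$ is $W|_{[n]}=(W_{ij})_{1\le i,j\le n}\in\mathcal{W}_n$. A random infinite rewiring map $W$ (a random element with respect to the $\sigma$-field generated by the restrictions $W|_{[n]}$, $n\in\mathbb{N}$) is \emph{exchangeable} if $(W_{\sigma(i)\sigma(j)})_{i,j}$ has the same law as $W$ for every permutation $\sigma$ of $\mathbb{N}$ that moves only finitely many points. For $m\le n$, $V\in\mathcal{W}_m$ and $w\in\mathcal{W}_n$, let \[ t(V,w)=\frac{\#\{\psi:[m]\to[n]\text{ injective} : (w_{\psi(i)\psi(j)})_{1\le i,j\le m}=V\}}{n(n-1)\cdots(n-m+1)}. \] An infinite rewiring map $W$ \emph{has a rewiring limit} if $t(V,W)=\lim_{n\to\infty}t(V,W|_{[n]})$ exists for every $V\in\mathcal{W}^*=\bigcup_{m\ge 1}\mathcal{W}_m$;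 its rewiring limit is then $|W|=(t(V,W))_{V\in\mathcal{W}^*}\in[0,1]^{\mathcal{W}^*}$. \textbf{Statement.} Let $W$ be an exchangeable random infinite rewiring map. Then, almost surely, the rewiring limit $|W|$ exists. -/

import Mathlib

open MeasureTheory ProbabilityTheory Filter Topology

/-- A rewiring map on the vertex set `ι`: a symmetric array with entries
`w i j = (w⁰ i j, w¹ i j)` in `{0,1} × {0,1}` (`Bool × Bool`) and all diagonal entries `(0,0)`.
It acts on graphs with vertex set `ι` by replacing the status `G i j` of each pair by `w⁰ i j`
if `G i j = 0` and by `w¹ i j` if `G i j = 1`.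
The rewiring maps of `n` vertices are `RewiringMap (Fin n)`, the infinite ones are
`RewiringMap ℕ` (vertices are labelled from `0` instead of `1`). -/
@[ext]
structure RewiringMap (ι : Type*) where
  entry : ι → ι → Bool × Bool
  symm : ∀ i j, entry i j = entry j i
  diag : ∀ i, entry i i = (false, false)

namespace RewiringMap

/-- `W^ψ = (W_{ψ(i)ψ(j)})_{i,j}`. -/
def comap {ι κ : Type*} (ψ : ι → κ) (W : RewiringMap κ) : RewiringMap ι where
  entry i j := W.entry (ψ i) (ψ j)
  symm i j := W.symm (ψ i) (ψ j)
  diag i := W.diag (ψ i)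

/-- The restriction of an infinite rewiring map to the first `n` vertices. -/
def restrict (n : ℕ) (W : RewiringMap ℕ) : RewiringMap (Fin n) :=
  W.comap (fun i : Fin n => (i : ℕ))

/-- The `σ`-field generated by the entries (the trace of the product `σ`-field on arrays); on
`RewiringMap ℕ` it is the one generated by the restrictions to the first `n` vertices, `n ∈ ℕ`. -/
instance (ι : Type*) : MeasurableSpace (RewiringMap ι) :=
  MeasurableSpace.comap RewiringMap.entry MeasurableSpace.pi

/-- The number of injections `ψ : [m] → [n]` with `W^ψ = V`. -/
noncomputable def ind {m n : ℕ} (V : RewiringMap (Fin m)) (W : RewiringMap (Fin n)) : ℕ :=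
  Nat.card {ψ : Fin m ↪ Fin n // W.comap ψ = V}

/-- The density `t(V, W) = ind(V, W) / (n (n - 1) ⋯ (n - m + 1))` of `V` in the finite rewiring
map `W` (only meaningful for `m ≤ n`; it is `0` for `n < m`). -/
noncomputable def density {m n : ℕ} (V : RewiringMap (Fin m)) (W : RewiringMap (Fin n)) : ℝ :=
  (ind V W : ℝ) / (n.descFactorial m : ℝ)

/-- The limiting density `t(V, W)` of `V` in the infinite rewiring map `W` exists and is `x`. -/
def HasLimitingDensity {m : ℕ} (V : RewiringMap (Fin m)) (W : RewiringMap ℕ) (x : ℝ) : Prop :=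
  Tendsto (fun n : ℕ => density V (W.restrict n)) atTop (𝓝 x)

/-- The countable collection of all finite rewiring maps, over all sizes `m ≥ 1`. -/
abbrev Finitary : Type := Σ m : ℕ+, RewiringMap (Fin m)

/-- The rewiring limit `|W| = (t(V, W))_V`, an element of `[0,1]^𝒲*`, exists and is `υ`. -/
def HasRewiringLimit (W : RewiringMap ℕ) (υ : Finitary → unitInterval) : Prop :=
  ∀ V : Finitary, HasLimitingDensity V.2 W (υ V)

/-- A random infinite rewiring map `W` is exchangeable: `W^σ` and `W` have the same law
for all permutations `σ` of `ℕ` that move only finitely many points. -/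
def Exchangeable {Ω : Type*} [MeasurableSpace Ω] (W : Ω → RewiringMap ℕ) (μ : Measure Ω) : Prop :=
  ∀ σ : Equiv.Perm ℕ, {i | σ i ≠ i}.Finite →
    IdentDistrib (fun ω => (W ω).comap σ) W μ μ

end RewiringMap

/-! The proof is a second-moment argument. Write `d n` for the density of a fixed pattern `V` of
size `m` in `W|_[n]`. Then `E[d n * d N]` averages, over pairs of injections, the probability that
both copies equal `V`. By exchangeability this probability is one constant `a` for all pairs with
disjoint ranges, and at most a fraction `m² / N` of the pairs overlap. Expanding the square cancels
`a`, so `E[(d N - d n)²] ≤ 4m² / n` for `n ≤ N` (`integral_density_sub_sq_le`).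

Along `n = r ^ 4` the `L¹`-increments are therefore `O(1 / r²)`, and `d` converges almost surely on
this subsequence. Counts of copies are monotone in `n` and consecutive fourth powers have ratio
tending to 1, so the whole sequence converges (`tendsto_div_descFactorial_of_monotone`). Finally,
there are only countably many patterns. -/

/-! ### Permutations and counts of injections -/

/-- Any two injections of a finite set into `ℕ` differ by a finitely supported permutation. -/
theorem exists_perm_finite_support_comp_eq {k : ℕ} {x y : Fin k → ℕ}
    (hx : Function.Injective x) (hy : Function.Injective y) :
    ∃ σ : Equiv.Perm ℕ, {i | σ i ≠ i}.Finite ∧ ∀ i, σ (x i) = y i := by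
  obtain ⟨K, hK⟩ : ∃ K, ∀ i, x i < K ∧ y i < K := by
    refine ⟨∑ i, (x i + y i + 1), fun i => ?_⟩
    have := Finset.single_le_sum (f := fun i => x i + y i + 1) (fun _ _ => Nat.zero_le _)
      (Finset.mem_univ i)
    omega
  let x' : Fin k ↪ Fin K := ⟨fun i => ⟨x i, (hK i).1⟩, fun i j h => hx (by simpa using h)⟩
  let y' : Fin k ↪ Fin K := ⟨fun i => ⟨y i, (hK i).2⟩, fun i j h => hy (by simpa using h)⟩
  obtain ⟨g, hg⟩ := MulAction.isMultiplyPretransitive_iff.1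
    (Equiv.Perm.isMultiplyPretransitive (Fin K) k) x' y'
  -- `viaEmbedding` extends `g` by the identity off `{0, …, K - 1}`.
  refine ⟨g.viaEmbedding Fin.valEmbedding, (Set.finite_lt_nat K).subset fun i hi => ?_, fun i => ?_⟩
  · by_contra h
    refine hi (g.viaEmbedding_apply_of_notMem _ _ ?_)
    rintro ⟨j, rfl⟩
    exact h j.2
  · have h1 := g.viaEmbedding_apply Fin.valEmbedding (x' i)
    have h2 : g (x' i) = y' i := by rw [← hg]; rfl
    rw [h2] at h1
    exact h1

/-- Composing with the swap of two values shows that all `N` fibres of `φ ↦ φ j` have the same size.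
-/
theorem mul_card_embedding_apply_eq {m N : ℕ} (j : Fin m) (c : Fin N) :
    N * (Finset.univ.filter fun φ : Fin m ↪ Fin N => φ j = c).card = N.descFactorial m := by
  have h (d : Fin N) : (Finset.univ.filter fun φ : Fin m ↪ Fin N => φ j = d).card =
      (Finset.univ.filter fun φ : Fin m ↪ Fin N => φ j = c).card := by
    refine Finset.card_equiv (Equiv.embeddingCongr (Equiv.refl _) (Equiv.swap c d)) fun φ => ?_
    simp [Equiv.embeddingCongr, Equiv.swap_apply_eq_iff]
  have h2 := Finset.card_eq_sum_card_fiberwise (f := fun φ : Fin m ↪ Fin N => φ j)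
    (s := Finset.univ) (t := Finset.univ) (by simp)
  simp only [h, Finset.sum_const, Finset.card_univ, Fintype.card_fin, smul_eq_mul] at h2
  rw [← h2, Fintype.card_embedding_eq, Fintype.card_fin, Fintype.card_fin]

theorem mul_card_embedding_val_eq_le {m N : ℕ} (j : Fin m) (c : ℕ) :
    N * (Finset.univ.filter fun φ : Fin m ↪ Fin N => (φ j : ℕ) = c).card ≤ N.descFactorial m := by
  by_cases hc : c < N
  · rw [← mul_card_embedding_apply_eq j ⟨c, hc⟩]
    simp [Fin.ext_iff]
  · have : (Finset.univ.filter fun φ : Fin m ↪ Fin N => (φ j : ℕ) = c) = ∅ := by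
      refine Finset.filter_eq_empty_iff.2 fun φ _ h => hc (h ▸ (φ j).2)
    simp [this]

/-- An average over pairs of injections of a `[0,1]`-valued function which is constant on pairs
with disjoint ranges is close to that constant. -/
theorem abs_sum_sum_embedding_sub_le {m n N : ℕ} (hN : 0 < N) (p : (Fin m → ℕ) → (Fin m → ℕ) → ℝ)
    (a : ℝ) (hp : ∀ ψ φ, |p ψ φ - a| ≤ 1)
    (h : ∀ ψ φ : Fin m → ℕ, Function.Injective ψ → Function.Injective φ →
      (∀ i j, ψ i ≠ φ j) → p ψ φ = a) :
    |∑ ψ : Fin m ↪ Fin n, ∑ φ : Fin m ↪ Fin N, (p (fun i => ψ i) (fun i => φ i) - a)| ≤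
      n.descFactorial m * (N.descFactorial m * ((m : ℝ) ^ 2 / N)) := by
  have key (ψ : Fin m ↪ Fin n) :
      |∑ φ : Fin m ↪ Fin N, (p (fun i => ψ i) (fun i => φ i) - a)| ≤
        N.descFactorial m * ((m : ℝ) ^ 2 / N) := by
    -- Union bound over the `m²` possible collisions `φ j = ψ i`, each of which holds for at most a
    -- fraction `1 / N` of the `φ`.
    calc |∑ φ : Fin m ↪ Fin N, (p (fun i => ψ i) (fun i => φ i) - a)|
        ≤ ∑ φ : Fin m ↪ Fin N, ∑ i : Fin m, ∑ j : Fin m,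
            (if (φ j : ℕ) = ψ i then (1 : ℝ) else 0) := by
          refine (Finset.abs_sum_le_sum_abs _ _).trans (Finset.sum_le_sum fun φ _ => ?_)
          have h0 (i j : Fin m) : (0 : ℝ) ≤ if (φ j : ℕ) = ψ i then (1 : ℝ) else 0 := by
            split_ifs <;> norm_num
          by_cases hd : ∀ i j, (ψ i : ℕ) ≠ φ j
          · rw [h (fun i => ψ i) (fun i => φ i) (Fin.val_injective.comp ψ.injective) (Fin.val_injective.comp φ.injective) hd,
              sub_self, abs_zero]
            exact Finset.sum_nonneg fun i _ => Finset.sum_nonneg fun j _ => h0 i j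
          · push Not at hd
            obtain ⟨i, j, hij⟩ := hd
            refine (hp _ _).trans ?_
            calc (1 : ℝ) = if (φ j : ℕ) = ψ i then (1 : ℝ) else 0 := by simp [hij]
              _ ≤ ∑ j : Fin m, if (φ j : ℕ) = ψ i then (1 : ℝ) else 0 :=
                Finset.single_le_sum (f := fun j => if (φ j : ℕ) = ψ i then (1 : ℝ) else 0)
                  (fun j _ => h0 i j) (Finset.mem_univ j)
              _ ≤ _ := Finset.single_le_sum
                  (f := fun i => ∑ j : Fin m, if (φ j : ℕ) = ψ i then (1 : ℝ) else 0)
                  (fun i _ => Finset.sum_nonneg fun j _ => h0 i j) (Finset.mem_univ i)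
      _ = ∑ i : Fin m, ∑ j : Fin m,
            ((Finset.univ.filter fun φ : Fin m ↪ Fin N => (φ j : ℕ) = ψ i).card : ℝ) := by
          rw [Finset.sum_comm]
          refine Finset.sum_congr rfl fun i _ => ?_
          rw [Finset.sum_comm]
          simp
      _ ≤ ∑ i : Fin m, ∑ j : Fin m, (N.descFactorial m : ℝ) / N := by
          gcongr with i _ j _
          rw [le_div_iff₀ (by positivity), mul_comm]
          exact_mod_cast mul_card_embedding_val_eq_le j (ψ i : ℕ)
      _ = N.descFactorial m * ((m : ℝ) ^ 2 / N) := by simp; ring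
  calc _ ≤ ∑ ψ : Fin m ↪ Fin n, (N.descFactorial m * ((m : ℝ) ^ 2 / N)) :=
        (Finset.abs_sum_le_sum_abs _ _).trans (Finset.sum_le_sum fun ψ _ => key ψ)
    _ = _ := by simp [Fintype.card_embedding_eq]

/-! ### Almost sure convergence and interpolation -/

/-- A sequence of random variables with summable `L¹`-increments is almost surely Cauchy. -/
theorem ae_cauchySeq_of_summable_integral_abs_sub {Ω : Type*} [MeasurableSpace Ω] {μ : Measure Ω}
    {f : ℕ → Ω → ℝ} (hf : ∀ k, Integrable (f k) μ) {b : ℕ → ℝ} (hb : Summable b)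
    (h : ∀ k, ∫ ω, |f (k + 1) ω - f k ω| ∂μ ≤ b k) :
    ∀ᵐ ω ∂μ, CauchySeq fun k => f k ω := by
  have hi (k : ℕ) : Integrable (fun ω => f (k + 1) ω - f k ω) μ := (hf (k + 1)).sub (hf k)
  -- By Tonelli the total variation of the sequence has finite mean, hence is almost surely finite.
  have hfin : ∫⁻ ω, ∑' k, ‖f (k + 1) ω - f k ω‖ₑ ∂μ ≠ ⊤ := by
    rw [lintegral_tsum fun k => (hi k).1.enorm]
    refine ne_top_of_le_ne_top (b := ∑' k, ENNReal.ofReal (b k)) ?_ (ENNReal.tsum_le_tsum fun k => ?_)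
    · exact hb.tsum_ofReal_ne_top
    · rw [← ofReal_integral_norm_eq_lintegral_enorm (hi k)]
      exact ENNReal.ofReal_le_ofReal (h k)
  filter_upwards [ae_lt_top' (AEMeasurable.tsum fun k => (hi k).1.enorm) hfin] with ω hω
  refine cauchySeq_of_summable_dist ?_
  have : Summable fun k => ‖f (k + 1) ω - f k ω‖₊ :=
    ENNReal.tsum_coe_ne_top_iff_summable.1 hω.ne
  have h2 := NNReal.summable_coe.2 this
  refine h2.congr fun k => ?_
  rw [dist_comm, dist_eq_norm, coe_nnnorm]

/-- Since `n.descFactorial m` is asymptotic to `n ^ m`, the ratio behaves like `(1 + 1 / (k + c)) ^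
(4 * m)`. -/
theorem tendsto_descFactorial_succ_pow_div (m c : ℕ) :
    Tendsto (fun k : ℕ => ((((k + 1 + c) ^ 4).descFactorial m : ℕ) : ℝ) /
      (((k + c) ^ 4).descFactorial m : ℕ)) atTop (𝓝 1) := by
  have h0 : Tendsto (fun k : ℕ => k + c) atTop atTop := tendsto_add_atTop_nat c
  have h1 : Tendsto (fun k : ℕ => (k + c) ^ 4) atTop atTop :=
    (tendsto_pow_atTop (by norm_num)).comp h0
  have h2 : Tendsto (fun k : ℕ => (k + 1 + c) ^ 4) atTop atTop :=
    h1.comp (tendsto_add_atTop_nat 1)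
  have e1 := (isEquivalent_descFactorial m).comp_tendsto h1
  have e2 := (isEquivalent_descFactorial m).comp_tendsto h2
  refine (e2.div e1).symm.tendsto_nhds ?_
  have h3 : Tendsto (fun k : ℕ => (1 + 1 / ((k + c : ℕ) : ℝ)) ^ (4 * m)) atTop (𝓝 1) := by
    have := ((tendsto_one_div_atTop_nhds_zero_nat (𝕜 := ℝ)).comp h0).const_add 1
    simpa using this.pow (4 * m)
  refine h3.congr' ?_
  filter_upwards [h0.eventually_gt_atTop 0] with k hk
  have hk' : (0 : ℝ) < ((k + c : ℕ) : ℝ) := by exact_mod_cast hk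
  simp only [Function.comp, Pi.div_apply]
  push_cast at hk' ⊢
  rw [← pow_mul, ← pow_mul, ← div_pow]
  congr 1
  field_simp
  ring

/-- Interpolation: convergence of `s n / (n)ₘ` along fourth powers gives convergence, if `s` is
monotone. -/
theorem tendsto_div_descFactorial_of_monotone {m c : ℕ} {s : ℕ → ℝ} (hs : Monotone s)
    (hs0 : ∀ n, 0 ≤ s n) {x : ℝ}
    (h : Tendsto (fun k : ℕ => s ((k + c) ^ 4) / (((k + c) ^ 4).descFactorial m : ℕ))
      atTop (𝓝 x)) :
    Tendsto (fun n : ℕ => s n / (n.descFactorial m : ℕ)) atTop (𝓝 x) := by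
  -- `κ n + c` is the integer fourth root of `n` once that root is at least `c`; below that the
  -- subtraction truncates.
  let κ : ℕ → ℕ := fun n => n.sqrt.sqrt - c
  have hsq : Tendsto Nat.sqrt atTop atTop :=
    tendsto_atTop.2 fun b => by
      filter_upwards [eventually_ge_atTop (b * b)] with n hn using Nat.le_sqrt.2 hn
  have hκ : Tendsto κ atTop atTop := (tendsto_sub_atTop_nat c).comp (hsq.comp hsq)
  have hr := tendsto_descFactorial_succ_pow_div m c
  have h1 : Tendsto (fun k : ℕ => s ((k + c) ^ 4) / (((k + 1 + c) ^ 4).descFactorial m : ℕ))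
      atTop (𝓝 x) := by
    have := h.div hr one_ne_zero
    rw [div_one] at this
    refine this.congr' ?_
    filter_upwards [eventually_ge_atTop m] with k hk
    have : (((k + c) ^ 4).descFactorial m : ℝ) ≠ 0 := by
      have : m ≤ (k + c) ^ 4 := (hk.trans (Nat.le_add_right k c)).trans (Nat.le_self_pow (by norm_num) _)
      exact_mod_cast (Nat.descFactorial_pos.2 this).ne'
    rw [Pi.div_apply, div_div_div_cancel_right₀ this]
  have h2 : Tendsto (fun k : ℕ => s ((k + 1 + c) ^ 4) / (((k + c) ^ 4).descFactorial m : ℕ))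
      atTop (𝓝 x) := by
    have := (h.comp (tendsto_add_atTop_nat 1)).mul hr
    rw [mul_one] at this
    refine this.congr' ?_
    filter_upwards [eventually_ge_atTop m] with k hk
    have : (((k + 1 + c) ^ 4).descFactorial m : ℝ) ≠ 0 := by
      have : m ≤ (k + 1 + c) ^ 4 := le_trans (by omega) (Nat.le_self_pow (n := 4) (by norm_num) _)
      exact_mod_cast (Nat.descFactorial_pos.2 this).ne'
    simp only [Function.comp]
    rw [div_mul_div_cancel₀ this]
  have hev : ∀ᶠ n : ℕ in atTop, m ≤ (κ n + c) ^ 4 ∧ (κ n + c) ^ 4 ≤ n ∧ n ≤ (κ n + 1 + c) ^ 4 := by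
    filter_upwards [hκ.eventually_ge_atTop m, (hsq.comp hsq).eventually_ge_atTop c] with n hm hc
    have e : κ n + c = n.sqrt.sqrt := Nat.sub_add_cancel hc
    refine ⟨(hm.trans (Nat.le_add_right _ c)).trans (Nat.le_self_pow (by norm_num) _), ?_, ?_⟩
    · rw [e]
      calc n.sqrt.sqrt ^ 4 = (n.sqrt.sqrt ^ 2) ^ 2 := by ring
        _ ≤ n.sqrt ^ 2 := by gcongr; exact Nat.sqrt_le' _
        _ ≤ n := Nat.sqrt_le' _
    · rw [add_right_comm, e]
      calc n ≤ (n.sqrt + 1) ^ 2 := (Nat.lt_succ_sqrt' n).le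
        _ ≤ ((n.sqrt.sqrt + 1) ^ 2) ^ 2 := by gcongr; exact Nat.lt_succ_sqrt' _
        _ = _ := by ring
  refine tendsto_of_tendsto_of_tendsto_of_le_of_le' (h1.comp hκ) (h2.comp hκ) ?_ ?_
  all_goals
    filter_upwards [hev] with n hn
    obtain ⟨ha, hb, hc⟩ := hn
    have p1 : (0 : ℝ) < ((κ n + c) ^ 4).descFactorial m := by
      exact_mod_cast Nat.descFactorial_pos.2 ha
    have p2 : (((κ n + c) ^ 4).descFactorial m : ℝ) ≤ n.descFactorial m := by
      exact_mod_cast Nat.descFactorial_le m hb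
    have p3 : (n.descFactorial m : ℝ) ≤ ((κ n + 1 + c) ^ 4).descFactorial m := by
      exact_mod_cast Nat.descFactorial_le m hc
    simp only [Function.comp]
  · exact div_le_div₀ (hs0 _) (hs hb) (p1.trans_le p2) p3
  · exact div_le_div₀ (hs0 _) (hs hc) p1 p2

/-! ### Moments of pattern densities -/

namespace RewiringMap

theorem measurableSet_comap_eq {m : ℕ} (V : RewiringMap (Fin m)) (ψ : Fin m → ℕ) :
    MeasurableSet {w : RewiringMap ℕ | w.comap ψ = V} := by
  have : {w : RewiringMap ℕ | w.comap ψ = V} =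
      ⋂ i, ⋂ j, {w | w.entry (ψ i) (ψ j) = V.entry i j} := by
    ext w
    simp only [Set.mem_ofPred_eq, Set.mem_iInter, RewiringMap.ext_iff, funext_iff]
    rfl
  rw [this]
  refine MeasurableSet.iInter fun i => MeasurableSet.iInter fun j => ?_
  have h : Measurable fun w : RewiringMap ℕ => w.entry (ψ i) (ψ j) :=
    (measurable_pi_apply (ψ j)).comp ((measurable_pi_apply (ψ i)).comp
      (comap_measurable RewiringMap.entry))
  exact h (measurableSet_singleton _)

variable {Ω : Type*} [MeasurableSpace Ω] {μ : Measure Ω} [IsProbabilityMeasure μ]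
  {W : Ω → RewiringMap ℕ} {m : ℕ}

/-- The probability that `W` restricts to `V` along both of two injections with disjoint ranges
does not depend on the injections. -/
theorem Exchangeable.exists_measureReal_comap_eq (hexch : Exchangeable W μ)
    (V : RewiringMap (Fin m)) :
    ∃ a : ℝ, 0 ≤ a ∧ a ≤ 1 ∧ ∀ ψ φ : Fin m → ℕ, Function.Injective ψ → Function.Injective φ →
      (∀ i j, ψ i ≠ φ j) → μ.real {ω | (W ω).comap ψ = V ∧ (W ω).comap φ = V} = a := by
  refine ⟨μ.real {ω | (W ω).comap (fun i : Fin m => (Fin.castAdd m i : ℕ)) = V ∧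
    (W ω).comap (fun i : Fin m => (Fin.natAdd m i : ℕ)) = V}, measureReal_nonneg,
    measureReal_le_one, fun ψ φ hψ hφ hd => ?_⟩
  -- Disjointness of the ranges makes the concatenation of `ψ` and `φ` injective, so one `σ` carries
  -- the first `2m` vertices onto both at once.
  obtain ⟨σ, hσ, hσ'⟩ := exists_perm_finite_support_comp_eq (x := fun i : Fin (m + m) => (i : ℕ))
    (y := Fin.append ψ φ) Fin.val_injective (Fin.append_injective_iff.2 ⟨hψ, hφ, hd⟩)
  have hs := (measurableSet_comap_eq V (fun i : Fin m => (Fin.castAdd m i : ℕ))).inter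
    (measurableSet_comap_eq V (fun i : Fin m => (Fin.natAdd m i : ℕ)))
  have h := (hexch σ hσ).measure_mem_eq hs
  have e1 : (fun i : Fin m => σ (Fin.castAdd m i : ℕ)) = ψ := by
    ext i; rw [hσ', Fin.append_left]
  have e2 : (fun i : Fin m => σ (Fin.natAdd m i : ℕ)) = φ := by
    ext i; rw [hσ', Fin.append_right]
  subst e1 e2
  exact congrArg ENNReal.toReal h

open Classical in
theorem density_restrict_eq {n : ℕ} (V : RewiringMap (Fin m)) (w : RewiringMap ℕ) :
    density V (w.restrict n) =
      (∑ ψ : Fin m ↪ Fin n, if w.comap (fun i => (ψ i : ℕ)) = V then (1 : ℝ) else 0) /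
        n.descFactorial m := by
  unfold density ind
  congr 1
  rw [Nat.card_eq_fintype_card, Fintype.card_subtype]
  simp only [Finset.sum_boole]
  rfl

/-- The interpolation needs the counts, since the densities themselves need not be monotone. -/
theorem ind_restrict_mono (V : RewiringMap (Fin m)) (w : RewiringMap ℕ) :
    Monotone fun n => ind V (w.restrict n) := by
  intro n N h
  refine Nat.card_le_card_of_injective
    (fun ψ : {ψ : Fin m ↪ Fin n // (w.restrict n).comap ψ = V} =>
      (⟨ψ.1.trans (Fin.castLEEmb h), ψ.2⟩ :
        {ψ : Fin m ↪ Fin N // (w.restrict N).comap ψ = V})) fun ψ φ e => ?_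
  ext i
  have := congrArg (fun χ => (χ.1 i : ℕ)) e
  simpa using this

theorem ind_le_descFactorial {n : ℕ} (V : RewiringMap (Fin m)) (w : RewiringMap (Fin n)) :
    ind V w ≤ n.descFactorial m := by
  refine (Nat.card_le_card_of_injective _ Subtype.val_injective).trans ?_
  simp [Fintype.card_embedding_eq]

theorem density_mem_Icc {n : ℕ} (V : RewiringMap (Fin m)) (w : RewiringMap (Fin n)) :
    density V w ∈ Set.Icc (0 : ℝ) 1 :=
  ⟨by unfold density; positivity,
    div_le_one_of_le₀ (by exact_mod_cast ind_le_descFactorial V w) (by positivity)⟩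

theorem measurable_density_restrict (hW : Measurable W) (V : RewiringMap (Fin m)) (n : ℕ) :
    Measurable fun ω => density V ((W ω).restrict n) := by
  classical
  simp only [density_restrict_eq]
  exact (Finset.measurable_sum _ fun ψ _ => Measurable.ite
    (hW (measurableSet_comap_eq V _)) measurable_const measurable_const).div_const _

theorem integrable_density_mul (hW : Measurable W) (V : RewiringMap (Fin m)) (n N : ℕ) :
    Integrable (fun ω => density V ((W ω).restrict n) * density V ((W ω).restrict N)) μ := by
  refine Integrable.of_bound ((measurable_density_restrict hW V n).mul
    (measurable_density_restrict hW V N)).aestronglyMeasurable 1 (ae_of_all _ fun ω => ?_)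
  have h1 := density_mem_Icc V ((W ω).restrict n)
  have h2 := density_mem_Icc V ((W ω).restrict N)
  rw [Real.norm_of_nonneg (mul_nonneg h1.1 h2.1)]
  exact mul_le_one₀ h1.2 h2.1 h2.2

theorem integrable_density (hW : Measurable W) (V : RewiringMap (Fin m)) (n : ℕ) :
    Integrable (fun ω => density V ((W ω).restrict n)) μ := by
  refine Integrable.of_bound (measurable_density_restrict hW V n).aestronglyMeasurable 1
    (ae_of_all _ fun ω => ?_)
  have h1 := density_mem_Icc V ((W ω).restrict n)
  rw [Real.norm_of_nonneg h1.1]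
  exact h1.2

theorem integral_density_mul_density (hW : Measurable W) (V : RewiringMap (Fin m)) (n N : ℕ) :
    ∫ ω, density V ((W ω).restrict n) * density V ((W ω).restrict N) ∂μ =
      (∑ ψ : Fin m ↪ Fin n, ∑ φ : Fin m ↪ Fin N,
        μ.real {ω | (W ω).comap (fun i => (ψ i : ℕ)) = V ∧
          (W ω).comap (fun i => (φ i : ℕ)) = V}) / (n.descFactorial m * N.descFactorial m) := by
  classical
  have hs (ψ φ : Fin m → ℕ) : MeasurableSet {ω | (W ω).comap ψ = V ∧ (W ω).comap φ = V} :=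
    (hW (measurableSet_comap_eq V ψ)).inter (hW (measurableSet_comap_eq V φ))
  simp only [density_restrict_eq, div_mul_div_comm, Finset.sum_mul_sum]
  rw [integral_div]
  congr 1
  have hmul (ψ φ : Fin m → ℕ) :
      (fun ω => (if (W ω).comap ψ = V then (1 : ℝ) else 0) * if (W ω).comap φ = V then 1 else 0) =
        Set.indicator {ω | (W ω).comap ψ = V ∧ (W ω).comap φ = V} fun _ => (1 : ℝ) := by
    ext ω
    by_cases h1 : (W ω).comap ψ = V <;> by_cases h2 : (W ω).comap φ = V <;>
      simp [Set.indicator, h1, h2]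
  have hint (ψ φ : Fin m → ℕ) : Integrable (fun ω => (if (W ω).comap ψ = V then (1 : ℝ) else 0) *
      if (W ω).comap φ = V then 1 else 0) μ := by
    rw [hmul]
    exact (integrable_const _).indicator (hs _ _)
  rw [integral_finsetSum _ fun ψ _ => integrable_finsetSum _ fun φ _ => hint _ _]
  refine Finset.sum_congr rfl fun ψ _ => ?_
  rw [integral_finsetSum _ fun φ _ => hint _ _]
  refine Finset.sum_congr rfl fun φ _ => ?_
  rw [hmul, integral_indicator (hs _ _)]
  simp

theorem Exchangeable.exists_abs_integral_density_mul_density_sub_le (hW : Measurable W)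
    (hexch : Exchangeable W μ) (V : RewiringMap (Fin m)) :
    ∃ a : ℝ, ∀ n N : ℕ, m ≤ n → m ≤ N → 0 < N →
      |∫ ω, density V ((W ω).restrict n) * density V ((W ω).restrict N) ∂μ - a| ≤
        (m : ℝ) ^ 2 / N := by
  obtain ⟨a, ha0, ha1, ha⟩ := hexch.exists_measureReal_comap_eq V
  refine ⟨a, fun n N hn hN hN0 => ?_⟩
  have p1 : (0 : ℝ) < n.descFactorial m := by exact_mod_cast Nat.descFactorial_pos.2 hn
  have p2 : (0 : ℝ) < N.descFactorial m := by exact_mod_cast Nat.descFactorial_pos.2 hN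
  have key := abs_sum_sum_embedding_sub_le (n := n) hN0
    (fun ψ φ => μ.real {ω | (W ω).comap ψ = V ∧ (W ω).comap φ = V}) a
    (fun ψ φ => by
      have h0 : 0 ≤ μ.real {ω | (W ω).comap ψ = V ∧ (W ω).comap φ = V} := measureReal_nonneg
      have h1 : μ.real {ω | (W ω).comap ψ = V ∧ (W ω).comap φ = V} ≤ 1 := measureReal_le_one
      rw [abs_le]
      constructor <;> linarith) ha
  simp only [Finset.sum_sub_distrib, Finset.sum_const, Finset.card_univ,
    Fintype.card_embedding_eq, Fintype.card_fin, nsmul_eq_mul] at key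
  rw [integral_density_mul_density hW, div_sub' (mul_pos p1 p2).ne', abs_div,
    abs_of_pos (mul_pos p1 p2), div_le_iff₀ (mul_pos p1 p2)]
  refine le_trans (le_of_eq ?_) (key.trans (le_of_eq (by ring)))
  rw [mul_assoc]

/-- The three moments in the expanded square are each within `m² / n` of the same `a`; their
coefficients `1, 1, -2` sum to 0 and have absolute sum 4. -/
theorem Exchangeable.integral_density_sub_sq_le (hW : Measurable W)
    (hexch : Exchangeable W μ) (V : RewiringMap (Fin m)) {n N : ℕ} (hn : m ≤ n) (hn0 : 0 < n)
    (h : n ≤ N) :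
    ∫ ω, (density V ((W ω).restrict N) - density V ((W ω).restrict n)) ^ 2 ∂μ ≤
      4 * (m : ℝ) ^ 2 / n := by
  obtain ⟨a, ha⟩ := hexch.exists_abs_integral_density_mul_density_sub_le hW V
  have h1 := (abs_le.1 (ha n n hn hn hn0)).2
  have h2 := (abs_le.1 (ha n N hn (hn.trans h) (hn0.trans_le h))).1
  have h3 := (abs_le.1 (ha N N (hn.trans h) (hn.trans h) (hn0.trans_le h))).2
  have h4 : (m : ℝ) ^ 2 / N ≤ (m : ℝ) ^ 2 / n := by gcongr
  have e : ∀ ω, (density V ((W ω).restrict N) - density V ((W ω).restrict n)) ^ 2 =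
      density V ((W ω).restrict N) * density V ((W ω).restrict N) +
      density V ((W ω).restrict n) * density V ((W ω).restrict n) -
      2 * (density V ((W ω).restrict n) * density V ((W ω).restrict N)) := fun ω => by ring
  simp only [e]
  have hadd : Integrable (fun ω => density V ((W ω).restrict N) * density V ((W ω).restrict N) +
      density V ((W ω).restrict n) * density V ((W ω).restrict n)) μ :=
    (integrable_density_mul hW V N N).add (integrable_density_mul hW V n n)
  rw [integral_sub hadd ((integrable_density_mul hW V n N).const_mul 2), integral_add (integrable_density_mul hW V N N) (integrable_density_mul hW V n n),
    integral_const_mul, mul_div_assoc]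
  linarith

theorem Exchangeable.integral_abs_density_sub_le (hW : Measurable W)
    (hexch : Exchangeable W μ) (V : RewiringMap (Fin m)) (k : ℕ) :
    ∫ ω, |density V ((W ω).restrict ((k + 1 + (m + 1)) ^ 4)) -
      density V ((W ω).restrict ((k + (m + 1)) ^ 4))| ∂μ ≤
      (1 + 4 * (m : ℝ) ^ 2) * (1 / ((k + (m + 1) : ℕ) : ℝ) ^ 2) := by
  -- The shift by `m + 1` ensures both `0 < r` and `m ≤ r ^ 4`.
  set r : ℕ := k + (m + 1) with hr
  have hr0 : (0 : ℝ) < r := by exact_mod_cast (by omega : 0 < r)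
  have hsq := hexch.integral_density_sub_sq_le hW V (n := r ^ 4) (N := (k + 1 + (m + 1)) ^ 4)
    (le_trans (by omega) (Nat.le_self_pow (n := 4) (by norm_num) r)) (pow_pos (by omega) 4)
    (Nat.pow_le_pow_left (by omega) 4)
  set D : Ω → ℝ := fun ω => density V ((W ω).restrict ((k + 1 + (m + 1)) ^ 4)) -
    density V ((W ω).restrict (r ^ 4)) with hD
  have hDi : Integrable D μ := (integrable_density hW V _).sub (integrable_density hW V _)
  have hD2 : Integrable (fun ω => D ω ^ 2) μ := by
    refine Integrable.of_bound (hDi.1.pow 2) 1 (ae_of_all _ fun ω => ?_)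
    have h1 := density_mem_Icc V ((W ω).restrict ((k + 1 + (m + 1)) ^ 4))
    have h2 := density_mem_Icc V ((W ω).restrict (r ^ 4))
    rw [Real.norm_of_nonneg (sq_nonneg _), sq_le_one_iff_abs_le_one, abs_le]
    constructor <;> simp only [hD] <;> linarith [h1.1, h1.2, h2.1, h2.2]
  -- From `x * y ≤ x² + y²` with `x = 1 / r` and `y = r * |D ω|`: as `E[D²]` is `O(1 / r ^ 4)`, this
  -- weight makes both terms of order `1 / r²`.
  have hpt (ω : Ω) : |D ω| ≤ 1 / (r : ℝ) ^ 2 + (r : ℝ) ^ 2 * D ω ^ 2 := by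
    have h1 : |D ω| = 1 / r * (r * |D ω|) := by field_simp
    have h2 : 1 / (r : ℝ) ^ 2 + (r : ℝ) ^ 2 * D ω ^ 2 = (1 / r) ^ 2 + (r * |D ω|) ^ 2 := by
      rw [mul_pow, sq_abs, div_pow, one_pow]
    rw [h1, h2, ← h1]
    nlinarith [sq_nonneg (1 / r - r * |D ω|), sq_nonneg (1 / (r : ℝ)), sq_nonneg (r * |D ω|)]
  calc ∫ ω, |D ω| ∂μ ≤ ∫ ω, (1 / (r : ℝ) ^ 2 + (r : ℝ) ^ 2 * D ω ^ 2) ∂μ :=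
        integral_mono hDi.abs ((integrable_const _).add (hD2.const_mul _)) hpt
    _ = 1 / (r : ℝ) ^ 2 + (r : ℝ) ^ 2 * ∫ ω, D ω ^ 2 ∂μ := by
        rw [integral_add (integrable_const _) (hD2.const_mul _), integral_const_mul]
        simp
    _ ≤ 1 / (r : ℝ) ^ 2 + (r : ℝ) ^ 2 * (4 * (m : ℝ) ^ 2 / ((r ^ 4 : ℕ) : ℝ)) := by gcongr
    _ = _ := by
        push_cast
        field_simp

/-! ### Existence of the limits -/

theorem Exchangeable.ae_exists_hasLimitingDensity (hW : Measurable W)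
    (hexch : Exchangeable W μ) (V : RewiringMap (Fin m)) :
    ∀ᵐ ω ∂μ, ∃ x, HasLimitingDensity V (W ω) x := by
  have hsum : Summable fun k : ℕ => (1 + 4 * (m : ℝ) ^ 2) * (1 / ((k + (m + 1) : ℕ) : ℝ) ^ 2) :=
    ((summable_nat_add_iff (m + 1)).2
      (Real.summable_one_div_nat_pow.2 one_lt_two)).mul_left _
  filter_upwards [ae_cauchySeq_of_summable_integral_abs_sub
    (fun k => integrable_density hW V ((k + (m + 1)) ^ 4)) hsum
    (hexch.integral_abs_density_sub_le hW V)] with ω hω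
  obtain ⟨x, hx⟩ := cauchySeq_tendsto_of_complete hω
  exact ⟨x, tendsto_div_descFactorial_of_monotone
    (s := fun n => (ind V ((W ω).restrict n) : ℝ))
    (fun n N h => Nat.cast_le.2 (ind_restrict_mono V (W ω) h)) (fun n => by positivity) hx⟩

instance (n : ℕ) : Finite (RewiringMap (Fin n)) :=
  Finite.of_injective RewiringMap.entry fun _ _ h => RewiringMap.ext h

end RewiringMap

theorem mainTheorem3 {Ω : Type*} [MeasurableSpace Ω] (μ : Measure Ω) [IsProbabilityMeasure μ]
    (W : Ω → RewiringMap ℕ) (hW : Measurable W) (hexch : RewiringMap.Exchangeable W μ) :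
    ∀ᵐ ω ∂μ, ∃ υ : RewiringMap.Finitary → unitInterval,
      RewiringMap.HasRewiringLimit (W ω) υ := by
  have h : ∀ᵐ ω ∂μ, ∀ V : RewiringMap.Finitary, ∃ x, RewiringMap.HasLimitingDensity V.2 (W ω) x :=
    ae_all_iff.2 fun V => hexch.ae_exists_hasLimitingDensity hW V.2
  filter_upwards [h] with ω hω
  choose x hx using hω
  -- Limits of densities stay in the closed interval `[0,1]`.
  exact ⟨fun V => ⟨x V, isClosed_Icc.mem_of_tendsto (hx V)
    (Eventually.of_forall fun n => RewiringMap.density_mem_Icc V.2 _)⟩, hx⟩
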